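/- Let $K/F$ be a cyclic Galois extension of number fields of degree $n$, with $\mathrm{Gal}(K/F)=\langle\sigma\rangle$ and rings of integers $\mathcal O_F\subseteq\mathcal O_K$. Let $u\in\mathcal O_F$, $u \neq 0$, and let $\mathcal A=(K/F,\sigma,u)=\bigoplus_{j=0}^{n-1}Kz^j$ be the cyclic algebra with multiplication given by $zk=\sigma(k)z$ for $k\in K$ and $z^n=u$. Let $\Lambda=\bigoplus_{j=0}^{n-1}\mathcal O_Kz^j\subseteq\mathcal A$ be its natural order, and for an ideal $I$ of $\mathcal O_F$ let $I\Lambda$ be the two-sided ideal of $\Lambda$ generated by $I$. Let $\mathfrak q$ be a nonzero prime ideal of $\mathcal O_F$ such that $\mathfrak q\mathcal O_K=\mathfrak Q_1\mathfrak Q_2\cdots\mathfrak Q_g$ with $g>1$ and $\mathfrak Q_1,\dots,\mathfrak Q_g$ distinct prime ideals of $\mathcal O_K$. Suppose $u\notin\mathfrak q$, and let $s>1$ be an integer. Then: (1) $\Lambda/\mathfrak q^s\Lambda\cong M_n(\mathcal O_F/\mathfrak q^s)$. (2) The proper two-sided ideals $\mathcal J$ of $\Lambda$ that contain $\mathfrak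 q^s\Lambda$ are exactly the ideals $\mathcal J_t=\mathfrak q^t\Lambda$ with $1\le t\le s$. (3) For $1\le t\le s$ one has $\mathfrak q^t\Lambda=\bigoplus_{j=0}^{n-1}\mathfrak q^t\mathcal O_Kz^j$ and $\Lambda/\mathfrak q^t\Lambda\cong M_n(\mathcal O_F/\mathfrak q^t)$. The isomorphisms are isomorphisms of $\mathcal O_F$-algebras. -/

import Mathlib

open scoped NumberField

/-- The generalized cyclic algebra `(S/R, σ, u) = ⊕_{i<n} S z^i` attached to a commutative
`R`-algebra `S`, an `R`-automorphism `σ` of `S` with `σ ^ n = 1` and an element `u` of `R`.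
The element with coefficients `x` is `∑ i, x i • z ^ i`; the multiplication, defined below,
is the one with `z s = σ(s) z` and `z ^ n = u`. -/
@[ext]
structure GenCyclicAlgebra (R S : Type*) [CommRing R] [CommRing S] [Algebra R S]
    (n : ℕ) [NeZero n] (σ : S ≃ₐ[R] S) (hσ : σ ^ n = 1) (u : R) where
  /-- The coefficients on the left `S`-basis `1, z, …, z ^ (n - 1)`. -/
  coeff : Fin n → S

namespace GenCyclicAlgebra

variable {R S : Type*} [CommRing R] [CommRing S] [Algebra R S]
variable {n : ℕ} [NeZero n] {σ : S ≃ₐ[R] S} {hσ : σ ^ n = 1} {u : R}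

theorem coeff_injective :
    Function.Injective (coeff : GenCyclicAlgebra R S n σ hσ u → Fin n → S) :=
  fun _ _ h => GenCyclicAlgebra.ext h

instance : Zero (GenCyclicAlgebra R S n σ hσ u) := ⟨⟨0⟩⟩
instance : Add (GenCyclicAlgebra R S n σ hσ u) := ⟨fun x y => ⟨x.coeff + y.coeff⟩⟩
instance : Neg (GenCyclicAlgebra R S n σ hσ u) := ⟨fun x => ⟨-x.coeff⟩⟩
instance : Sub (GenCyclicAlgebra R S n σ hσ u) := ⟨fun x y => ⟨x.coeff - y.coeff⟩⟩
instance : SMul ℕ (GenCyclicAlgebra R S n σ hσ u) := ⟨fun t x => ⟨t • x.coeff⟩⟩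
instance : SMul ℤ (GenCyclicAlgebra R S n σ hσ u) := ⟨fun t x => ⟨t • x.coeff⟩⟩
instance : SMul R (GenCyclicAlgebra R S n σ hσ u) := ⟨fun t x => ⟨t • x.coeff⟩⟩

/-- `a z^i * b z^j = a σ^i(b) z^(i+j)`, and `z^(i+j) = u z^(i+j-n)` when `n ≤ i + j`;
the sum `i + j` inside `Fin n` is taken modulo `n`. -/
instance : Mul (GenCyclicAlgebra R S n σ hσ u) :=
  ⟨fun x y => ⟨fun k => ∑ i : Fin n, ∑ j : Fin n,
    if i + j = k then
      x.coeff i * (σ ^ (i : ℕ)) (y.coeff j)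
        * (if (i : ℕ) + (j : ℕ) < n then 1 else algebraMap R S u)
    else 0⟩⟩

/-- The monomial `a z^i`. -/
def single (i : Fin n) (a : S) : GenCyclicAlgebra R S n σ hσ u := ⟨Pi.single i a⟩

instance : One (GenCyclicAlgebra R S n σ hσ u) := ⟨single 0 1⟩

@[simp] theorem coeff_zero : (0 : GenCyclicAlgebra R S n σ hσ u).coeff = 0 := rfl
@[simp] theorem coeff_add (x y : GenCyclicAlgebra R S n σ hσ u) :
    (x + y).coeff = x.coeff + y.coeff := rfl
@[simp] theorem coeff_neg (x : GenCyclicAlgebra R S n σ hσ u) : (-x).coeff = -x.coeff := rfl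
@[simp] theorem coeff_sub (x y : GenCyclicAlgebra R S n σ hσ u) :
    (x - y).coeff = x.coeff - y.coeff := rfl
@[simp] theorem coeff_smul (t : R) (x : GenCyclicAlgebra R S n σ hσ u) :
    (t • x).coeff = t • x.coeff := rfl
@[simp] theorem coeff_single (i : Fin n) (a : S) :
    (single i a : GenCyclicAlgebra R S n σ hσ u).coeff = Pi.single i a := rfl
theorem coeff_mul (x y : GenCyclicAlgebra R S n σ hσ u) (k : Fin n) :
    (x * y).coeff k = ∑ i : Fin n, ∑ j : Fin n,
      if i + j = k then
        x.coeff i * (σ ^ (i : ℕ)) (y.coeff j)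
          * (if (i : ℕ) + (j : ℕ) < n then 1 else algebraMap R S u)
      else 0 := rfl
theorem one_def : (1 : GenCyclicAlgebra R S n σ hσ u) = single 0 1 := rfl

instance : AddCommGroup (GenCyclicAlgebra R S n σ hσ u) :=
  coeff_injective.addCommGroup coeff rfl (fun _ _ => rfl) (fun _ => rfl) (fun _ _ => rfl)
    (fun _ _ => rfl) (fun _ _ => rfl)

instance : NonUnitalNonAssocRing (GenCyclicAlgebra R S n σ hσ u) where
  zero_mul x := by ext k; simp [coeff_mul]
  mul_zero x := by ext k; simp [coeff_mul]
  left_distrib x y z := by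
    ext k
    simp only [coeff_mul, coeff_add, Pi.add_apply, ← Finset.sum_add_distrib]
    refine Finset.sum_congr rfl fun i _ => Finset.sum_congr rfl fun j _ => ?_
    rw [map_add]
    split_ifs <;> ring
  right_distrib x y z := by
    ext k
    simp only [coeff_mul, coeff_add, Pi.add_apply, ← Finset.sum_add_distrib]
    refine Finset.sum_congr rfl fun i _ => Finset.sum_congr rfl fun j _ => ?_
    split_ifs <;> ring

theorem sum_single (x : GenCyclicAlgebra R S n σ hσ u) : ∑ i, single i (x.coeff i) = x := by
  let f : GenCyclicAlgebra R S n σ hσ u →+ (Fin n → S) :=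
    { toFun := coeff, map_zero' := rfl, map_add' := fun _ _ => rfl }
  apply coeff_injective
  change f _ = f x
  rw [map_sum]
  exact Finset.univ_sum_single x.coeff

theorem single_mul_single (i j : Fin n) (a b : S) :
    (single i a * single j b : GenCyclicAlgebra R S n σ hσ u) =
      single (i + j) (a * (σ ^ (i : ℕ)) b
        * (if (i : ℕ) + (j : ℕ) < n then 1 else algebraMap R S u)) := by
  ext k
  rw [coeff_mul, Finset.sum_eq_single i, Finset.sum_eq_single j]
  · by_cases h : i + j = k
    · subst h; simp
    · simp [h, Ne.symm h]
  · intro b _ hb; simp [hb]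
  · simp
  · intro b _ hb; simp [hb]
  · simp

theorem pow_val_add (hσ : σ ^ n = 1) (i j : Fin n) :
    σ ^ ((i + j : Fin n) : ℕ) = σ ^ (i : ℕ) * σ ^ (j : ℕ) := by
  rw [Fin.val_add, ← pow_add]
  conv_rhs => rw [← Nat.mod_add_div (i + j : ℕ) n, pow_add, pow_mul, hσ, one_pow, mul_one]

theorem cocycle (v : S) (i j k : Fin n) :
    (if (i : ℕ) + j < n then 1 else v) * (if ((i + j : Fin n) : ℕ) + k < n then 1 else v) =
      (if (j : ℕ) + k < n then 1 else v) * (if (i : ℕ) + (j + k : Fin n) < n then 1 else v) := by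
  have hi := i.2
  have hj := j.2
  have hk := k.2
  have h1 : ((i + j : Fin n) : ℕ) = if (i : ℕ) + j < n then (i : ℕ) + j else i + j - n := by
    rw [Fin.val_add]
    split_ifs with h
    · exact Nat.mod_eq_of_lt h
    · rw [Nat.mod_eq_sub_mod (by omega), Nat.mod_eq_of_lt (by omega)]
  have h2 : ((j + k : Fin n) : ℕ) = if (j : ℕ) + k < n then (j : ℕ) + k else j + k - n := by
    rw [Fin.val_add]
    split_ifs with h
    · exact Nat.mod_eq_of_lt h
    · rw [Nat.mod_eq_sub_mod (by omega), Nat.mod_eq_of_lt (by omega)]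
  rw [h1, h2]
  split_ifs <;> first | rfl | omega | simp

theorem single_assoc (i j k : Fin n) (a b c : S) :
    (single i a * single j b * single k c : GenCyclicAlgebra R S n σ hσ u) =
      single i a * (single j b * single k c) := by
  simp only [single_mul_single, add_assoc]
  congr 1
  have hfix : (σ ^ (i : ℕ)) (if (j : ℕ) + (k : ℕ) < n then 1 else algebraMap R S u)
      = if (j : ℕ) + (k : ℕ) < n then 1 else algebraMap R S u := by
    split_ifs
    · exact map_one _
    · exact AlgEquiv.commutes _ _
  rw [map_mul, map_mul, hfix, pow_val_add hσ, AlgEquiv.mul_apply]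
  have := cocycle (algebraMap R S u) i j k
  linear_combination (a * (σ ^ (i : ℕ)) b * (σ ^ (i : ℕ)) ((σ ^ (j : ℕ)) c)) * this

instance : Ring (GenCyclicAlgebra R S n σ hσ u) where
  mul_assoc x y z := by
    rw [← sum_single x, ← sum_single y, ← sum_single z]
    simp only [Finset.sum_mul, Finset.mul_sum, single_assoc]
  one_mul x := by
    conv_lhs => rw [← sum_single x]
    conv_rhs => rw [← sum_single x]
    simp [one_def, Finset.mul_sum, single_mul_single]
  mul_one x := by
    conv_lhs => rw [← sum_single x]
    conv_rhs => rw [← sum_single x]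
    simp [one_def, Finset.sum_mul, single_mul_single]
  zsmul := (· • ·)
  zsmul_zero' := zero_zsmul
  zsmul_succ' n x := SubNegMonoid.zsmul_succ' n x
  zsmul_neg' n x := SubNegMonoid.zsmul_neg' n x
  nsmul := (· • ·)
  nsmul_zero := zero_nsmul
  nsmul_succ n x := succ_nsmul x n
  sub_eq_add_neg := sub_eq_add_neg
  neg_add_cancel := neg_add_cancel

instance : Module R (GenCyclicAlgebra R S n σ hσ u) :=
  coeff_injective.module R
    { toFun := coeff, map_zero' := rfl, map_add' := fun _ _ => rfl } (fun _ _ => rfl)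

instance : Algebra R (GenCyclicAlgebra R S n σ hσ u) :=
  Algebra.ofModule
    (fun t x y => by
      ext k
      simp only [coeff_mul, coeff_smul, Pi.smul_apply, Finset.smul_sum, smul_ite, smul_zero,
        smul_mul_assoc])
    (fun t x y => by
      ext k
      simp only [coeff_mul, coeff_smul, Pi.smul_apply, Finset.smul_sum, smul_ite, smul_zero,
        map_smul, smul_mul_assoc, mul_smul_comm])

theorem algebraMap_eq (t : R) :
    algebraMap R (GenCyclicAlgebra R S n σ hσ u) t = single 0 (algebraMap R S t) := by
  rw [Algebra.algebraMap_eq_smul_one]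
  ext k
  by_cases hk : k = 0
  · subst hk; simp [one_def, Algebra.algebraMap_eq_smul_one]
  · simp [one_def, hk]

end GenCyclicAlgebra

theorem galois_pow_finrank_eq_one {F K : Type*} [Field F] [Field K] [Algebra F K]
    [FiniteDimensional F K] [IsGalois F K] (σ : K ≃ₐ[F] K) : σ ^ Module.finrank F K = 1 := by
  rw [← IsGalois.card_aut_eq_finrank F K]
  exact pow_card_eq_one'

instance finrank_neZero {F K : Type*} [Field F] [Field K] [Algebra F K]
    [FiniteDimensional F K] : NeZero (Module.finrank F K) :=
  ⟨Module.finrank_pos.ne'⟩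

/-- The cyclic algebra `(K/F, σ, u) = K ⊕ K z ⊕ ⋯ ⊕ K z^(n-1)`, `n = [K : F]`, with
`z k = σ(k) z` and `z ^ n = u`. -/
abbrev CyclicAlgebra (F K : Type*) [Field F] [Field K] [Algebra F K]
    [FiniteDimensional F K] [IsGalois F K] (σ : K ≃ₐ[F] K) (u : F) : Type _ :=
  GenCyclicAlgebra F K (Module.finrank F K) σ (galois_pow_finrank_eq_one σ) u

section NaturalOrder

variable (F K : Type*) [Field F] [Field K] [NumberField F] [NumberField K] [Algebra F K]
  [FiniteDimensional F K] [IsGalois F K]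

/-- The natural order `Λ = 𝓞 K ⊕ 𝓞 K z ⊕ ⋯ ⊕ 𝓞 K z^(n-1)` inside `(K/F, σ, u)`, for `u` in
`𝓞 F`, as an `𝓞 F`-subalgebra. -/
def naturalOrder (σ : K ≃ₐ[F] K) (u : 𝓞 F) :
    Subalgebra (𝓞 F) (CyclicAlgebra F K σ (u : F)) where
  carrier := {x | ∀ i, IsIntegral ℤ (x.coeff i)}
  mul_mem' {x y} hx hy k := by
    rw [GenCyclicAlgebra.coeff_mul]
    refine IsIntegral.sum _ fun i _ => IsIntegral.sum _ fun j _ => ?_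
    split_ifs
    · exact ((hx i).mul ((hy j).map ((σ ^ (i : ℕ) : K ≃ₐ[F] K) : K →+* K).toIntAlgHom)).mul
        isIntegral_one
    · exact ((hx i).mul ((hy j).map ((σ ^ (i : ℕ) : K ≃ₐ[F] K) : K →+* K).toIntAlgHom)).mul
        (u.isIntegral_coe.map (algebraMap F K).toIntAlgHom)
    · exact isIntegral_zero
  add_mem' hx hy i := (hx i).add (hy i)
  algebraMap_mem' r i := by
    change IsIntegral ℤ ((algebraMap F (CyclicAlgebra F K σ (u : F)) r).coeff i)
    rw [GenCyclicAlgebra.algebraMap_eq, GenCyclicAlgebra.coeff_single, Pi.single_apply]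
    split_ifs
    · exact r.isIntegral_coe.map (algebraMap F K).toIntAlgHom
    · exact isIntegral_zero

variable {F K}

/-- The `i`-th coefficient, in `𝓞 K`, of an element of the natural order. -/
noncomputable def naturalOrder.coeff {σ : K ≃ₐ[F] K} {u : 𝓞 F} (x : naturalOrder F K σ u)
    (i : Fin (Module.finrank F K)) : 𝓞 K :=
  ⟨(x : CyclicAlgebra F K σ (u : F)).coeff i, x.2 i⟩

/-- The two-sided ideal `I Λ` of the natural order `Λ` generated by an ideal `I` of `𝓞 F`. -/
noncomputable def naturalOrder.extIdeal (σ : K ≃ₐ[F] K) (u : 𝓞 F) (I : Ideal (𝓞 F)) :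
    TwoSidedIdeal (naturalOrder F K σ u) :=
  TwoSidedIdeal.span (algebraMap (𝓞 F) (naturalOrder F K σ u) '' (I : Set (𝓞 F)))

end NaturalOrder

/-! Fix `t ≥ 1` and put A = 𝓞_F/q^t and B = 𝓞_K/q^t𝓞_K, a finite free A-module of rank n on which σ
acts. Since the `Q i` are distinct, q is unramified, so inertia is trivial: distinct powers of σ
differ modulo every maximal ideal of B. Hence Dedekind's independence of characters holds over the
ring B (`mem_of_sum_mul_mem`). It yields Hilbert 90 (`exists_isUnit_eq_mul_of_partialNorm_eq_one`),
and as B is finite, a count of units then makes every fixed unit a norm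
(`exists_isUnit_partialNorm_eq`). Write u = N(b) and let Λ act on B, 𝓞_K by multiplication and z by
y ↦ bσ(y). By independence the kernel of Λ → End_A(B) ≅ M_n(A) is ⊕ q^t𝓞_K z^j, and equal
cardinalities give surjectivity.

Two-sided ideals of Λ above q^sΛ correspond to those of a matrix ring, so they are generated by the
scalars they contain (`TwoSidedIdeal.eq_span_of_surjective_matrix`). These scalars form an ideal of
𝓞_F containing q^s, hence a power of q. -/

/-! ### Independence of characters over a ring. -/

/-- Ring homomorphisms which are pairwise distinct modulo every maximal ideal separate
coordinates: their joint values span the whole function space. -/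
theorem span_range_eval_eq_top {ι B C : Type*} [Fintype ι] [DecidableEq ι] [CommRing B]
    [CommRing C] (τ : ι → C →+* B)
    (hsep : ∀ i j, i ≠ j → ∀ Q : Ideal B, Q.IsMaximal → ∃ w, τ i w - τ j w ∉ Q) :
    Submodule.span B (Set.range fun (w : C) (i : ι) => τ i w) = ⊤ := by
  let h : C →* (ι → B) :=
    { toFun := fun w i => τ i w
      map_one' := by ext; simp
      map_mul' := fun x y => by ext; simp }
  -- The range of `h` is closed under products, so its span is already a subalgebra and products may
  -- be used to build idempotents.
  have hM : Subalgebra.toSubmodule (Algebra.adjoin B (Set.range h)) =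
      Submodule.span B (Set.range h) := by
    rw [Algebra.adjoin_eq_span, ← MonoidHom.coe_mrange, Submonoid.closure_eq]
  change Submodule.span B (Set.range h) = ⊤
  rw [← hM]
  set M := Algebra.adjoin B (Set.range h) with hMdef
  have hw : ∀ w, h w ∈ M := fun w => Algebra.subset_adjoin ⟨w, rfl⟩
  have hc : ∀ b : B, algebraMap B (ι → B) b ∈ M := fun b => M.algebraMap_mem b
  have hpair : ∀ i j, i ≠ j → ∃ f ∈ M, f i = 1 ∧ f j = 0 := by
    intro i j hij
    -- Values at `i` of the elements of `M` vanishing at `j`. By `hsep` this ideal lies in no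
    -- maximal ideal.
    let I : Ideal B :=
      { carrier := {b | ∃ f ∈ M, f i = b ∧ f j = 0}
        zero_mem' := ⟨0, M.zero_mem, rfl, rfl⟩
        add_mem' := by
          rintro _ _ ⟨f, hf, rfl, hf'⟩ ⟨g, hg, rfl, hg'⟩
          exact ⟨f + g, M.add_mem hf hg, rfl, by simp [hf', hg']⟩
        smul_mem' := by
          rintro c _ ⟨f, hf, rfl, hf'⟩
          exact ⟨c • f, M.smul_mem hf c, rfl, by simp [hf']⟩ }
    have hI : I = ⊤ := by
      by_contra hne
      obtain ⟨Q, hQ, hIQ⟩ := Ideal.exists_le_maximal I hne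
      obtain ⟨w, hwQ⟩ := hsep i j hij Q hQ
      refine hwQ (hIQ ⟨h w - algebraMap B _ (τ j w), M.sub_mem (hw w) (hc _), ?_, ?_⟩) <;>
        simp [h]
    have h1 : (1 : B) ∈ I := hI ▸ Submodule.mem_top
    exact h1
  choose! f hf hf1 hf0 using hpair
  have hδ : ∀ i, Pi.single i (1 : B) ∈ M := by
    intro i
    have : Pi.single i (1 : B) = ∏ j ∈ Finset.univ.erase i, f i j := by
      ext k
      rw [Finset.prod_apply]
      by_cases hk : k = i
      · subst hk
        rw [Pi.single_eq_same]
        exact (Finset.prod_eq_one fun j hj => hf1 _ _ (Finset.ne_of_mem_erase hj).symm).symm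
      · rw [Pi.single_eq_of_ne hk]
        exact (Finset.prod_eq_zero (f := fun j => f i j k)
          (Finset.mem_erase.2 ⟨hk, Finset.mem_univ k⟩) (hf0 i k (Ne.symm hk))).symm
    rw [this]
    exact M.prod_mem fun j hj => hf _ _ (Finset.ne_of_mem_erase hj).symm
  refine eq_top_iff.2 fun x _ => ?_
  have hx : x = ∑ i, x i • Pi.single i (1 : B) := by
    ext k
    simp [Finset.sum_apply, Pi.single_apply]
  rw [hx]
  exact Submodule.sum_mem _ fun i _ => M.smul_mem (hδ i) _

/-- Dedekind independence modulo `I`: a linear form with values in `I` on a spanning set has all its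
coefficients in `I`. It is applied with `I` maximal for Hilbert 90 and with `I = ⊥` for the kernel
of the representation. -/
theorem mem_of_sum_mul_mem {ι B C : Type*} [Fintype ι] [DecidableEq ι] [CommRing B]
    [CommRing C] (τ : ι → C →+* B)
    (hsep : ∀ i j, i ≠ j → ∀ Q : Ideal B, Q.IsMaximal → ∃ w, τ i w - τ j w ∉ Q)
    (I : Ideal B) (a : ι → B) (ha : ∀ w, ∑ i, a i * τ i w ∈ I) (i : ι) : a i ∈ I := by
  have key : ∀ f : ι → B, ∑ j, a j * f j ∈ I := by
    intro f
    have hf : f ∈ Submodule.span B (Set.range fun (w : C) (i : ι) => τ i w) := by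
      rw [span_range_eval_eq_top τ hsep]; trivial
    induction hf using Submodule.span_induction with
    | mem x hx => obtain ⟨w, rfl⟩ := hx; exact ha w
    | zero => simp
    | add x y _ _ hx hy =>
      simpa [mul_add, Finset.sum_add_distrib] using I.add_mem hx hy
    | smul c x _ hx =>
      simpa [Finset.mul_sum, mul_left_comm] using I.mul_mem_left c hx
  simpa [Pi.single_apply] using key (Pi.single i 1)

/-! ### Norms, Hilbert 90 and units that are norms. -/

section Norm

variable {R B : Type*} [CommRing R] [CommRing B] [Algebra R B] (σ : B ≃ₐ[R] B)

/-- The partial norm `b σ(b) ⋯ σ^(k-1)(b)`. -/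
def partialNorm (b : B) (k : ℕ) : B := ∏ j ∈ Finset.range k, (σ ^ j) b

theorem partialNorm_zero (b : B) : partialNorm σ b 0 = 1 := by simp [partialNorm]

theorem partialNorm_add (b : B) (i j : ℕ) :
    partialNorm σ b (i + j) = partialNorm σ b i * (σ ^ i) (partialNorm σ b j) := by
  simp only [partialNorm, Finset.prod_range_add, pow_add, map_prod, AlgEquiv.mul_apply]

theorem partialNorm_succ' (b : B) (i : ℕ) :
    partialNorm σ b (i + 1) = b * σ (partialNorm σ b i) := by
  rw [add_comm, partialNorm_add]
  simp [partialNorm]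

theorem partialNorm_mul (b c : B) (k : ℕ) :
    partialNorm σ (b * c) k = partialNorm σ b k * partialNorm σ c k := by
  simp [partialNorm, Finset.prod_mul_distrib]

theorem isUnit_partialNorm {b : B} (hb : IsUnit b) (k : ℕ) : IsUnit (partialNorm σ b k) := by
  simp only [partialNorm, IsUnit.prod_iff]
  exact fun j _ => hb.map (σ ^ j : B ≃ₐ[R] B)

theorem map_partialNorm_eq {n : ℕ} (hσ : σ ^ n = 1) (b : B) (hb : IsUnit b) :
    σ (partialNorm σ b n) = partialNorm σ b n := by
  apply hb.mul_left_cancel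
  rw [← partialNorm_succ', partialNorm_add, hσ, mul_comm]
  simp [partialNorm]

/-- Hilbert's Theorem 90 for a ring with a cyclic group of automorphisms which is free of inertia
and transitive on maximal ideals. -/
theorem exists_isUnit_eq_mul_of_partialNorm_eq_one {n : ℕ} [NeZero n] (hσ : σ ^ n = 1)
    (hsep : ∀ i j : Fin n, i ≠ j → ∀ Q : Ideal B, Q.IsMaximal →
      ∃ w, (σ ^ (i : ℕ)) w - (σ ^ (j : ℕ)) w ∉ Q)
    (htrans : ∀ Q Q' : Ideal B, Q.IsMaximal → Q'.IsMaximal →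
      ∃ k : ℕ, ∀ x, x ∈ Q' ↔ (σ ^ k) x ∈ Q)
    (b : B) (hb : partialNorm σ b n = 1) : ∃ c, IsUnit c ∧ c = b * σ c := by
  have hbu : IsUnit b := by
    obtain ⟨m, hm⟩ := Nat.exists_eq_succ_of_ne_zero (NeZero.ne n)
    rw [hm, Nat.succ_eq_add_one, partialNorm_succ'] at hb
    exact IsUnit.of_mul_eq_one _ hb
  -- The classical Hilbert 90 resolvent. Multiplying by `b` after applying `σ` shifts the index by
  -- one, and the new last term is the old first one because the norm is 1 and `σ ^ n = 1`.
  let T : B → B := fun y => ∑ i ∈ Finset.range n, partialNorm σ b i * (σ ^ i) y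
  have hT : ∀ y, T y = b * σ (T y) := by
    intro y
    have h1 : b * σ (T y) =
        ∑ i ∈ Finset.range n, partialNorm σ b (i + 1) * (σ ^ (i + 1)) y := by
      simp only [T, map_sum, Finset.mul_sum, map_mul, partialNorm_succ', pow_succ',
        AlgEquiv.mul_apply, mul_assoc]
    have h2 := Finset.sum_range_succ (fun i => partialNorm σ b i * (σ ^ i) y) n
    rw [Finset.sum_range_succ', hb, hσ, partialNorm_zero, pow_zero] at h2
    rw [h1]
    exact (add_right_cancel h2).symm
  rcases subsingleton_or_nontrivial B with hB | hB
  · exact ⟨1, isUnit_one, Subsingleton.elim _ _⟩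
  obtain ⟨Q, hQ⟩ := Ideal.exists_maximal B
  obtain ⟨y, hy⟩ : ∃ y, T y ∉ Q := by
    by_contra! hall
    have := mem_of_sum_mul_mem
      (fun i : Fin n => ((σ ^ (i : ℕ) : B ≃ₐ[R] B) : B →+* B)) hsep Q
      (fun i => partialNorm σ b i)
      (fun w => by simpa [T, Finset.sum_range] using hall w) 0
    simp only [Fin.val_zero, partialNorm_zero] at this
    exact hQ.ne_top ((Ideal.eq_top_iff_one _).2 this)
  refine ⟨T y, ?_, hT y⟩
  by_contra hnu
  obtain ⟨Q', hQ', hyQ'⟩ := exists_max_ideal_of_mem_nonunits hnu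
  -- Each conjugate of `T y` is a multiple of `T y`, so by transitivity lying in one maximal ideal
  -- would force lying in `Q`.
  obtain ⟨k, hk⟩ := htrans Q' Q hQ' hQ
  have hiter : ∀ k : ℕ, ∃ v, (σ ^ k) (T y) = v * T y := by
    intro k
    induction k with
    | zero => exact ⟨1, by simp⟩
    | succ k ih =>
      obtain ⟨v, hv⟩ := ih
      obtain ⟨b', hb'⟩ := hbu.exists_left_inv
      have h3 : σ (T y) = b' * T y := by
        conv_rhs => rw [hT y, ← mul_assoc, hb', one_mul]
      refine ⟨σ v * b', ?_⟩
      rw [pow_succ', AlgEquiv.mul_apply, hv, map_mul, h3, mul_assoc]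
  obtain ⟨v, hv⟩ := hiter k
  exact hy ((hk _).2 (hv ▸ Q'.mul_mem_left v hyQ'))

/-- Units fixed by the group are norms of units, when the ring is finite. -/
theorem exists_isUnit_partialNorm_eq [Finite B] {n : ℕ} [NeZero n] (hσ : σ ^ n = 1)
    (hsep : ∀ i j : Fin n, i ≠ j → ∀ Q : Ideal B, Q.IsMaximal →
      ∃ w, (σ ^ (i : ℕ)) w - (σ ^ (j : ℕ)) w ∉ Q)
    (htrans : ∀ Q Q' : Ideal B, Q.IsMaximal → Q'.IsMaximal →
      ∃ k : ℕ, ∀ x, x ∈ Q' ↔ (σ ^ k) x ∈ Q)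
    (u : B) (hu : IsUnit u) (hσu : σ u = u) : ∃ b, IsUnit b ∧ partialNorm σ b n = u := by
  let N : Bˣ →* Bˣ := Units.liftRight
    { toFun := fun b : Bˣ => partialNorm σ (b : B) n
      map_one' := by simp [partialNorm]
      map_mul' := fun x y => by simp [partialNorm_mul] }
    (fun b => (isUnit_partialNorm σ b.isUnit n).unit) (fun _ => rfl)
  have hN : ∀ b : Bˣ, (N b : B) = partialNorm σ (b : B) n := fun _ => rfl
  -- The map c ↦ c/σ(c); its kernel consists of the fixed units.
  let D : Bˣ →* Bˣ := MonoidHom.id _ / Units.map (σ : B →* B)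
  have hDker : ∀ c : Bˣ, c ∈ D.ker ↔ σ (c : B) = c := by
    intro c
    rw [MonoidHom.mem_ker, MonoidHom.div_apply, div_eq_one, Units.ext_iff]
    exact eq_comm
  have hle : N.range ≤ D.ker := by
    rintro _ ⟨b, rfl⟩
    rw [hDker]
    exact map_partialNorm_eq σ hσ b b.isUnit
  have hle' : N.ker ≤ D.range := by
    intro b hb
    obtain ⟨c, hc, hcb⟩ := exists_isUnit_eq_mul_of_partialNorm_eq_one σ hσ hsep htrans (b : B)
      (by rw [← hN, MonoidHom.mem_ker.1 hb, Units.val_one])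
    refine ⟨hc.unit, ?_⟩
    rw [MonoidHom.div_apply, div_eq_iff_eq_mul, Units.ext_iff]
    exact hcb
  have hcN := Subgroup.card_mul_index N.ker
  have hcD := Subgroup.card_mul_index D.ker
  rw [Subgroup.index_ker] at hcN hcD
  have h1 := Subgroup.card_le_of_le hle'
  -- The Herbrand quotient of a finite module is 1: |ker D||im D| = |ker N||im N|, and Hilbert 90
  -- gives |ker N| ≤ |im D|.
  have hcard : Nat.card D.ker ≤ Nat.card N.range := by
    have h2 : 0 < Nat.card D.range := Nat.card_pos
    refine Nat.le_of_mul_le_mul_right ?_ h2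
    calc Nat.card D.ker * Nat.card D.range = Nat.card N.ker * Nat.card N.range := by
          rw [hcN, hcD]
      _ ≤ Nat.card N.range * Nat.card D.range := by
          rw [mul_comm]; exact Nat.mul_le_mul_left _ h1
  have heq := Subgroup.eq_of_le_of_card_ge hle hcard
  have hmem : hu.unit ∈ N.range := by
    rw [heq, hDker]; exact hσu
  obtain ⟨b, hb⟩ := hmem
  exact ⟨b, b.isUnit, congrArg Units.val hb⟩

end Norm

/-! ### Splitting a cyclic algebra by its action on B. -/

namespace GenCyclicAlgebra

variable {R S D : Type*} [CommRing R] [CommRing S] [Algebra R S] [Ring D] [Algebra R D]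
variable {n : ℕ} [NeZero n] {σ : S ≃ₐ[R] S} {hσ : σ ^ n = 1} {u : R}

theorem single_add (i : Fin n) (a b : S) :
    (single i (a + b) : GenCyclicAlgebra R S n σ hσ u) = single i a + single i b := by
  ext k; simp [Pi.single_add]

/-- The universal property of the cyclic algebra `(S/R, σ, u)`. -/
noncomputable def lift (ψ : S →ₐ[R] D) (Z : D) (hZ : ∀ a, Z * ψ a = ψ (σ a) * Z)
    (hu : Z ^ n = algebraMap R D u) : GenCyclicAlgebra R S n σ hσ u →ₐ[R] D :=
  let L : GenCyclicAlgebra R S n σ hσ u →ₗ[R] D :=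
    { toFun := fun x => ∑ i : Fin n, ψ (x.coeff i) * Z ^ (i : ℕ)
      map_add' := fun x y => by simp [add_mul, Finset.sum_add_distrib]
      map_smul' := fun r x => by simp [Finset.smul_sum] }
  have hL : ∀ (i : Fin n) (a : S), L (single i a) = ψ a * Z ^ (i : ℕ) := fun i a => by
    change ∑ j : Fin n, ψ ((single i a : GenCyclicAlgebra R S n σ hσ u).coeff j) * Z ^ (j : ℕ) = _
    rw [Finset.sum_eq_single i]
    · simp
    · intro j _ hj; simp [hj]
    · simp
  have hZpow : ∀ (k : ℕ) (a : S), Z ^ k * ψ a = ψ ((σ ^ k) a) * Z ^ k := fun k a => by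
    induction k generalizing a with
    | zero => simp
    | succ k ih =>
      rw [pow_succ, mul_assoc, hZ, ← mul_assoc, ih, mul_assoc, pow_succ, AlgEquiv.mul_apply]
  AlgHom.ofLinearMap L
    (by rw [one_def, hL]; simp)
    (fun x y => by
      have hmono : ∀ (i j : Fin n) (a b : S),
          L (single i a * single j b) = L (single i a) * L (single j b) := by
        intro i j a b
        rw [single_mul_single, hL, hL, hL, mul_assoc (ψ a), ← mul_assoc (Z ^ _), hZpow,
          map_mul, map_mul]
        simp only [mul_assoc]
        congr 2
        rw [← pow_add, Fin.val_add]
        split_ifs with h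
        · rw [map_one, one_mul, Nat.mod_eq_of_lt h]
        · have hi := i.2
          have hj := j.2
          rw [AlgHom.commutes, ← hu, ← pow_add, Nat.mod_eq_sub_mod (by omega),
            Nat.mod_eq_of_lt (by omega)]
          congr 1
          omega
      rw [← sum_single x, ← sum_single y]
      simp only [Finset.sum_mul, Finset.mul_sum, map_sum, hmono])

theorem lift_apply (ψ : S →ₐ[R] D) (Z : D) (hZ : ∀ a, Z * ψ a = ψ (σ a) * Z)
    (hu : Z ^ n = algebraMap R D u) (x : GenCyclicAlgebra R S n σ hσ u) :
    lift ψ Z hZ hu x = ∑ i : Fin n, ψ (x.coeff i) * Z ^ (i : ℕ) := rfl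

/-- Over a finite ring on which the group acts without inertia and transitively on the maximal
ideals, a cyclic algebra with a unit parameter is a matrix algebra. -/
theorem exists_algHom_matrix_of_separating {A B : Type*} [CommRing A] [CommRing B] [Algebra R A]
    [Algebra R B] [Algebra A B] [IsScalarTower R A B] [Finite A] [Finite B] [Module.Free A B]
    [Nontrivial A] (hrank : Module.finrank A B = n) (π : S →ₐ[R] B) (hπ : Function.Surjective π)
    (τ : B ≃ₐ[A] B) (hτ : ∀ a, τ (π a) = π (σ a))
    (hsep : ∀ i j : Fin n, i ≠ j → ∀ Q : Ideal B, Q.IsMaximal →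
      ∃ w, (τ ^ (i : ℕ)) w - (τ ^ (j : ℕ)) w ∉ Q)
    (htrans : ∀ Q Q' : Ideal B, Q.IsMaximal → Q'.IsMaximal →
      ∃ k : ℕ, ∀ x, x ∈ Q' ↔ (τ ^ k) x ∈ Q)
    (hu : IsUnit (algebraMap R A u)) :
    ∃ f : GenCyclicAlgebra R S n σ hσ u →ₐ[R] Matrix (Fin n) (Fin n) A,
      Function.Surjective f ∧ ∀ x, f x = 0 ↔ ∀ i, π (x.coeff i) = 0 := by
  have hτk : ∀ (k : ℕ) a, (τ ^ k) (π a) = π ((σ ^ k) a) := by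
    intro k
    induction k with
    | zero => intro a; simp
    | succ k ih => intro a; rw [pow_succ, AlgEquiv.mul_apply, hτ, ih, pow_succ, AlgEquiv.mul_apply]
  have hτn : τ ^ n = 1 := by
    ext b
    obtain ⟨a, rfl⟩ := hπ b
    rw [hτk, hσ]
    rfl
  obtain ⟨b, hb, hbu⟩ := exists_isUnit_partialNorm_eq τ hτn hsep htrans _
    (hu.map (algebraMap A B)) (τ.commutes _)
  let ψ : S →ₐ[R] Module.End A B := ((Algebra.lmul A B).restrictScalars R).comp π
  -- Since `b` has norm `u`, the twisted automorphism y ↦ b τ(y) has n-th power equal to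
  -- multiplication by `u`.
  let Z : Module.End A B := Algebra.lmul A B b * τ.toLinearMap
  have hψ : ∀ a y, ψ a y = π a * y := fun a y => rfl
  have hZ1 : ∀ y, Z y = b * τ y := fun y => rfl
  have hZk : ∀ (k : ℕ) y, (Z ^ k) y = partialNorm τ b k * (τ ^ k) y := by
    intro k
    induction k with
    | zero => intro y; simp [partialNorm_zero]
    | succ k ih =>
      intro y
      rw [pow_succ', Module.End.mul_apply, ih, hZ1, map_mul, partialNorm_succ', pow_succ',
        AlgEquiv.mul_apply, mul_assoc]
  have hZψ : ∀ a, Z * ψ a = ψ (σ a) * Z := by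
    intro a
    ext y
    change Z (ψ a y) = ψ (σ a) (Z y)
    rw [hZ1, hψ, hψ, hZ1, map_mul, hτ]
    ring
  have hZn : Z ^ n = algebraMap R (Module.End A B) u := by
    ext y
    rw [hZk, hbu, hτn, AlgEquiv.one_apply, ← IsScalarTower.algebraMap_apply, ← Algebra.smul_def,
      Module.algebraMap_end_apply]
  let φ : GenCyclicAlgebra R S n σ hσ u →ₐ[R] Module.End A B := lift ψ Z hZψ hZn
  have hφ : ∀ x y, φ x y =
      ∑ i : Fin n, π (x.coeff i) * partialNorm τ b i * (τ ^ (i : ℕ)) y := by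
    intro x y
    simp only [φ, lift_apply, LinearMap.sum_apply, Module.End.mul_apply, hψ, hZk, mul_assoc]
  have hker : ∀ x, φ x = 0 ↔ ∀ i, π (x.coeff i) = 0 := by
    intro x
    constructor
    · intro hx i
      have := mem_of_sum_mul_mem
        (fun i : Fin n => ((τ ^ (i : ℕ) : B ≃ₐ[A] B) : B →+* B)) hsep ⊥
        (fun i => π (x.coeff i) * partialNorm τ b i)
        (fun w => by
          have h := hφ x w
          rw [hx, LinearMap.zero_apply] at h
          exact h.symm) i
      exact (isUnit_partialNorm τ hb i).mul_left_eq_zero.1 this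
    · intro hx
      ext y
      rw [hφ]
      exact Finset.sum_eq_zero fun i _ => by rw [hx i, zero_mul, zero_mul]
  let bas : Module.Basis (Fin n) A B := Module.finBasisOfFinrankEq A B hrank
  let e : Module.End A B ≃ₐ[A] Matrix (Fin n) (Fin n) A := LinearMap.toMatrixAlgEquiv bas
  -- Both sides count |A|^(n²), as B is free of rank n; so injectivity on coefficient vectors will
  -- give surjectivity.
  have hcard : Nat.card (Fin n → B) = Nat.card (Module.End A B) := by
    rw [Nat.card_congr e.toEquiv, Nat.card_fun, Nat.card_congr bas.equivFun.toEquiv,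
      Matrix, Nat.card_fun, Nat.card_fun, Nat.card_fun]
  have : Finite (Module.End A B) := Finite.of_equiv _ e.symm.toEquiv
  have hsurj : Function.Surjective φ := by
    choose s hs using hπ
    let θ : (Fin n → B) → Module.End A B := fun v => φ ⟨fun i => s (v i)⟩
    have hθ : Function.Injective θ := by
      intro v w hvw
      have h0 := (hker (⟨fun i => s (v i)⟩ - ⟨fun i => s (w i)⟩)).1
        (by rw [map_sub]; exact sub_eq_zero.2 hvw)
      ext i
      have h1 := h0 i
      rw [coeff_sub, Pi.sub_apply, map_sub, sub_eq_zero, hs, hs] at h1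
      exact h1
    have hθ' : Function.Bijective θ := (Nat.bijective_iff_injective_and_card θ).2 ⟨hθ, hcard⟩
    intro y
    obtain ⟨v, hv⟩ := hθ'.2 y
    exact ⟨_, hv⟩
  refine ⟨(e.restrictScalars R : Module.End A B →ₐ[R] Matrix (Fin n) (Fin n) A).comp φ,
    e.surjective.comp hsurj, fun x => ?_⟩
  rw [← hker]
  exact map_eq_zero_iff e e.injective

/-- Modulo an ideal of the base over which the group acts without inertia and transitively on
the maximal ideals, a cyclic algebra with a unit parameter is a matrix algebra. -/
theorem exists_algHom_matrix (I : Ideal R) [Nontrivial (R ⧸ I)] [Finite (R ⧸ I)]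
    [Finite (S ⧸ I.map (algebraMap R S))]
    [Module.Free (R ⧸ I) (S ⧸ I.map (algebraMap R S))]
    (hrank : Module.finrank (R ⧸ I) (S ⧸ I.map (algebraMap R S)) = n)
    (hsep : ∀ i j : Fin n, i ≠ j → ∀ Q : Ideal S, Q.IsMaximal → I.map (algebraMap R S) ≤ Q →
      ∃ w, (σ ^ (i : ℕ)) w - (σ ^ (j : ℕ)) w ∉ Q)
    (htrans : ∀ Q Q' : Ideal S, Q.IsMaximal → Q'.IsMaximal → I.map (algebraMap R S) ≤ Q →
      I.map (algebraMap R S) ≤ Q' → ∃ k : ℕ, ∀ x, x ∈ Q' ↔ (σ ^ k) x ∈ Q)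
    (hu : IsUnit (Ideal.Quotient.mk I u)) :
    ∃ f : GenCyclicAlgebra R S n σ hσ u →ₐ[R] Matrix (Fin n) (Fin n) (R ⧸ I),
      Function.Surjective f ∧
        ∀ x, f x = 0 ↔ ∀ i, x.coeff i ∈ I.map (algebraMap R S) := by
  let π : S →ₐ[R] S ⧸ I.map (algebraMap R S) := Ideal.Quotient.mkₐ R _
  have hπ : Function.Surjective π := Ideal.Quotient.mkₐ_surjective R _
  have hπ0 : ∀ x, π x = 0 ↔ x ∈ I.map (algebraMap R S) := fun x =>
    Ideal.Quotient.eq_zero_iff_mem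
  have hJσ : I.map (algebraMap R S) =
      (I.map (algebraMap R S)).map ((σ : S ≃ₐ[R] S) : S →+* S) := by
    rw [Ideal.map_map]
    congr 1
    ext r
    simp
  let τ : (S ⧸ I.map (algebraMap R S)) ≃ₐ[R ⧸ I] (S ⧸ I.map (algebraMap R S)) :=
    AlgEquiv.extendScalarsOfSurjective Ideal.Quotient.mk_surjective
      (Ideal.quotientEquivAlg _ _ σ hJσ)
  have hτ : ∀ a, τ (π a) = π (σ a) := fun a => rfl
  have hτk : ∀ (k : ℕ) a, (τ ^ k) (π a) = π ((σ ^ k) a) := by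
    intro k
    induction k with
    | zero => intro a; simp
    | succ k ih => intro a; rw [pow_succ, AlgEquiv.mul_apply, hτ, ih, pow_succ, AlgEquiv.mul_apply]
  have hcomap : ∀ Q : Ideal (S ⧸ I.map (algebraMap R S)),
      I.map (algebraMap R S) ≤ Q.comap π := fun Q x hx => by
    rw [Ideal.mem_comap, (hπ0 x).2 hx]
    exact Q.zero_mem
  have hmax : ∀ Q : Ideal (S ⧸ I.map (algebraMap R S)), Q.IsMaximal → (Q.comap π).IsMaximal :=
    fun Q hQ => Ideal.comap_isMaximal_of_surjective π hπ
  obtain ⟨f, hf, hker⟩ := exists_algHom_matrix_of_separating (hσ := hσ) (u := u) hrank π hπ τ hτ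
    (fun i j hij Q hQ => by
      obtain ⟨w, hw⟩ := hsep i j hij _ (hmax Q hQ) (hcomap Q)
      exact ⟨π w, by rwa [hτk, hτk, ← map_sub]⟩)
    (fun Q Q' hQ hQ' => by
      obtain ⟨k, hk⟩ := htrans _ _ (hmax Q hQ) (hmax Q' hQ') (hcomap Q) (hcomap Q')
      refine ⟨k, fun x => ?_⟩
      obtain ⟨a, rfl⟩ := hπ x
      rw [hτk]
      exact hk a) hu
  exact ⟨f, hf, fun x => (hker x).trans (forall_congr' fun i => hπ0 _)⟩

end GenCyclicAlgebra

/-! ### Two-sided ideals above the kernel of a map to matrices. -/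

section MatrixQuotient

variable {R Λ ι : Type*} [CommRing R] [Ring Λ] [Algebra R Λ] [Fintype ι] [DecidableEq ι]

theorem TwoSidedIdeal.nonempty_quotient_algEquiv {D : Type*} [Ring D] [Algebra R D]
    (J : TwoSidedIdeal Λ) (f : Λ →ₐ[R] D) (hf : Function.Surjective f)
    (hker : ∀ x, f x = 0 ↔ x ∈ J) : Nonempty (J.ringCon.Quotient ≃ₐ[R] D) := by
  have hrel : ∀ x y, J.ringCon x y ↔ f x = f y := fun x y => by
    rw [TwoSidedIdeal.rel_iff, ← hker, map_sub, sub_eq_zero]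
  refine ⟨AlgEquiv.ofBijective (J.ringCon.liftₐ f fun x y h => (hrel x y).1 h) ⟨?_, fun y => ?_⟩⟩
  · intro x y hxy
    induction x using Quotient.inductionOn with | _ x =>
    induction y using Quotient.inductionOn with | _ y =>
    exact Quotient.sound ((hrel x y).2 hxy)
  · obtain ⟨x, rfl⟩ := hf y
    exact ⟨(x : J.ringCon.Quotient), rfl⟩

/-- Two-sided ideals containing the kernel of a surjection onto a matrix algebra over a quotient
of the base ring are generated by their scalars. -/
theorem TwoSidedIdeal.eq_span_of_surjective_matrix (I : Ideal R)
    (f : Λ →ₐ[R] Matrix ι ι (R ⧸ I)) (hf : Function.Surjective f)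
    (hker : ∀ x, f x = 0 → x ∈ TwoSidedIdeal.span (algebraMap R Λ '' (I : Set R)))
    (J : TwoSidedIdeal Λ) (hJ : TwoSidedIdeal.span (algebraMap R Λ '' (I : Set R)) ≤ J) :
    J = TwoSidedIdeal.span (algebraMap R Λ '' {r | algebraMap R Λ r ∈ J}) := by
  apply le_antisymm
  · intro x hx
    choose e he using fun i j => hf (Matrix.single i j (1 : R ⧸ I))
    choose r hr using fun i j => Ideal.Quotient.mk_surjective (f x i j)
    have hfr : ∀ r : R, f (algebraMap R Λ r) =
        Matrix.scalar ι (Ideal.Quotient.mk I r) := fun r => by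
      rw [AlgHom.commutes]; rfl
    have hrJ : ∀ i j, algebraMap R Λ (r i j) ∈ J := by
      intro i j
      -- With X = f(x), the sum of E_ki X E_jk over k is the scalar matrix X_ij. So each entry of X
      -- lifts to a scalar lying in `J`.
      have h0 : f (algebraMap R Λ (r i j) - ∑ k, e k i * x * e j k) = 0 := by
        rw [map_sub, map_sum, hfr, hr]
        simp only [map_mul, he]
        ext a b
        by_cases hab : a = b
        · subst hab
          simp [Matrix.sum_apply, Matrix.single_apply]
        · simp only [Matrix.single_mul_mul_single, one_mul, mul_one, Matrix.sub_apply,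
            Matrix.scalar_apply, Matrix.diagonal_apply_ne _ hab, Matrix.sum_apply,
            Matrix.single_apply, Matrix.zero_apply, zero_sub, neg_eq_zero]
          exact Finset.sum_eq_zero fun c _ => if_neg fun h => hab (h.1.symm.trans h.2)
      have h1 : ∑ k, e k i * x * e j k ∈ J :=
        sum_mem fun k _ => J.mul_mem_right _ _ (J.mul_mem_left _ _ hx)
      have := J.add_mem (hJ (hker _ h0)) h1
      rwa [sub_add_cancel] at this
    have h0 : f (x - ∑ i, ∑ j, algebraMap R Λ (r i j) * e i j) = 0 := by
      simp only [map_sub, map_sum, map_mul, hfr, hr, he]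
      rw [sub_eq_zero]
      conv_lhs => rw [Matrix.matrix_eq_sum_single (f x)]
      refine Finset.sum_congr rfl fun i _ => Finset.sum_congr rfl fun j _ => ?_
      rw [Matrix.scalar_apply, ← Matrix.smul_eq_diagonal_mul, Matrix.smul_single, smul_eq_mul,
        mul_one]
    have hle : TwoSidedIdeal.span (algebraMap R Λ '' (I : Set R)) ≤
        TwoSidedIdeal.span (algebraMap R Λ '' {r | algebraMap R Λ r ∈ J}) :=
      TwoSidedIdeal.span_mono (Set.image_mono fun a ha =>
        hJ (TwoSidedIdeal.subset_span ⟨a, ha, rfl⟩))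
    have h2 := TwoSidedIdeal.add_mem _ (hle (hker _ h0))
      (sum_mem (t := Finset.univ) (f := fun i => ∑ j, algebraMap R Λ (r i j) * e i j)
        fun i _ => sum_mem fun j _ => TwoSidedIdeal.mul_mem_right _ _ (e i j)
          (TwoSidedIdeal.subset_span ⟨r i j, hrJ i j, rfl⟩))
    rwa [sub_add_cancel] at h2
  · rw [TwoSidedIdeal.span_le]
    rintro _ ⟨r, hr, rfl⟩
    exact hr

end MatrixQuotient

/-! ### Ramification, and freeness of the quotients. -/

section
variable {F K : Type*} [Field F] [Field K] [NumberField F] [NumberField K] [Algebra F K]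
  [FiniteDimensional F K] [IsGalois F K]

/-- The order of the inertia group is the ramification index, which is 1 because `P ^ 2` does not
divide the extension of `q`. -/
theorem inertia_eq_bot_of_squarefree_map (q : Ideal (𝓞 F)) [q.IsPrime] (hq0 : q ≠ ⊥)
    (hsq : Squarefree (q.map (algebraMap (𝓞 F) (𝓞 K)))) (P : Ideal (𝓞 K)) [P.IsPrime]
    [P.LiesOver q] : P.inertia (K ≃ₐ[F] K) = ⊥ := by
  have hP0 : P ≠ ⊥ := Ideal.ne_bot_of_liesOver_of_ne_bot hq0 P
  have hle : q.map (algebraMap (𝓞 F) (𝓞 K)) ≤ P :=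
    Ideal.map_le_iff_le_comap.2 (Ideal.over_def P q).le
  have : q.IsMaximal := Ideal.IsPrime.isMaximal ‹_› hq0
  have h1 : q.ramificationIdx' P = 1 := by
    refine Ideal.ramificationIdx'_spec (by rwa [pow_one]) fun h => ?_
    have := hsq P (by rw [← pow_two]; exact Ideal.dvd_iff_le.2 h)
    exact Ideal.IsPrime.ne_top ‹_› (Ideal.isUnit_iff.1 this)
  have : Finite (𝓞 F ⧸ q) := Ring.HasFiniteQuotients.finiteQuotient hq0
  have : Finite q.ResidueField :=
    Finite.of_surjective _ (Ideal.bijective_algebraMap_quotient_residueField q).2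
  rw [← Subgroup.card_eq_one, Ideal.card_inertia_eq_ramificationIdxIn (R := 𝓞 F) q P,
    Ideal.ramificationIdxIn_eq_ramificationIdx q P (K ≃ₐ[F] K),
    ← Ideal.ramificationIdx'_eq_ramificationIdx q P hq0, h1]

theorem Ideal.isLocalRing_quotient_pow {R : Type*} [CommRing R] (q : Ideal R) [hq : q.IsMaximal]
    {t : ℕ} (ht : t ≠ 0) : IsLocalRing (R ⧸ q ^ t) := by
  have : Nontrivial (R ⧸ q ^ t) := Ideal.Quotient.nontrivial_iff.2 fun h =>
    hq.ne_top (top_le_iff.1 (h ▸ Ideal.pow_le_self ht))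
  refine IsLocalRing.of_unique_max_ideal ⟨q.map (Ideal.Quotient.mk _), ?_, fun M hM => ?_⟩
  · exact Ideal.IsMaximal.map_of_surjective_of_ker_le Ideal.Quotient.mk_surjective
      (by rw [Ideal.mk_ker]; exact Ideal.pow_le_self ht)
  · have hc := Ideal.comap_isMaximal_of_surjective (K := M) _
      (Ideal.Quotient.mk_surjective (I := q ^ t))
    have hle : q ^ t ≤ M.comap (Ideal.Quotient.mk (q ^ t)) := fun x hx => by
      rw [Ideal.mem_comap, Ideal.Quotient.eq_zero_iff_mem.2 hx]; exact M.zero_mem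
    have hqM := hq.eq_of_le hc.ne_top (hc.isPrime.le_of_pow_le hle)
    exact (Ideal.map_comap_of_surjective _ Ideal.Quotient.mk_surjective M).symm.trans
      (congrArg (Ideal.map (Ideal.Quotient.mk (q ^ t))) hqM.symm)

/-- `S` need not be free over `R`, but its base change to the local ring `R ⧸ q ^ t` is finite and
flat, hence free. -/
theorem Ideal.free_quotient_map_pow {R S : Type*} [CommRing R] [CommRing S] [Algebra R S]
    [Module.Finite R S] [Module.Flat R S] (q : Ideal R) [q.IsMaximal] {t : ℕ} (ht : t ≠ 0) :
    Module.Free (R ⧸ q ^ t) (S ⧸ (q ^ t).map (algebraMap R S)) := by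
  have := q.isLocalRing_quotient_pow ht
  have : Module.Flat (R ⧸ q ^ t) (S ⧸ (q ^ t).map (algebraMap R S)) :=
    Module.Flat.of_linearEquiv
      (Algebra.TensorProduct.quotIdealMapEquivQuotTensor S (q ^ t)).toLinearEquiv
  have : Module.Finite (R ⧸ q ^ t) (S ⧸ (q ^ t).map (algebraMap R S)) :=
    Module.Finite.equiv
      (Algebra.TensorProduct.quotIdealMapEquivQuotTensor S (q ^ t)).symm.toLinearEquiv
  exact Module.free_of_flat_of_isLocalRing

theorem finrank_eq_of_natCard_eq_pow {A B : Type*} [CommRing A] [Nontrivial A] [Finite A]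
    [AddCommGroup B] [Module A B] [Module.Free A B] [Finite B] {n : ℕ}
    (h : Nat.card B = Nat.card A ^ n) : Module.finrank A B = n := by
  have hB := Nat.card_congr (Module.finBasis A B).equivFun.toEquiv
  rw [Nat.card_fun, Nat.card_fin, h] at hB
  exact (Nat.pow_right_injective Finite.one_lt_card hB).symm

-- The rank is read off from cardinalities: the absolute norm of the extended ideal is the n-th
-- power of that of `I`.
omit [FiniteDimensional F K] [IsGalois F K] in
theorem finrank_quotient_map_ringOfIntegers (I : Ideal (𝓞 F)) (hI0 : I ≠ ⊥) (hI : I ≠ ⊤)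
    [Module.Free (𝓞 F ⧸ I) (𝓞 K ⧸ I.map (algebraMap (𝓞 F) (𝓞 K)))] :
    Module.finrank (𝓞 F ⧸ I) (𝓞 K ⧸ I.map (algebraMap (𝓞 F) (𝓞 K))) = Module.finrank F K := by
  have : Finite (𝓞 F ⧸ I) := Ring.HasFiniteQuotients.finiteQuotient hI0
  have : Finite (𝓞 K ⧸ I.map (algebraMap (𝓞 F) (𝓞 K))) :=
    Ring.HasFiniteQuotients.finiteQuotient (Ideal.map_ne_bot_of_ne_bot hI0)
  have : Nontrivial (𝓞 F ⧸ I) := Ideal.Quotient.nontrivial_iff.2 hI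
  refine finrank_eq_of_natCard_eq_pow ?_
  rw [IsFractionRing.finrank_eq (𝓞 F) F (𝓞 K) K]
  exact Ideal.absNorm_algebraMap (𝓞 F) (𝓞 K) I

end

/-! ### The Galois action on the ring of integers. -/

section

variable {F K : Type*} [Field F] [Field K] [NumberField F] [NumberField K] [Algebra F K]
  [FiniteDimensional F K] [IsGalois F K]

/-- The restriction of an automorphism of `K` over `F` to the ring of integers. -/
noncomputable def integralAut (σ : K ≃ₐ[F] K) : 𝓞 K ≃ₐ[𝓞 F] 𝓞 K :=
  MulSemiringAction.toAlgAut (K ≃ₐ[F] K) (𝓞 F) (𝓞 K) σ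

omit [FiniteDimensional F K] in
theorem integralAut_pow_apply (σ : K ≃ₐ[F] K) (k : ℕ) (x : 𝓞 K) :
    (integralAut σ ^ k) x = (σ ^ k) • x := by
  rw [integralAut, ← map_pow]
  rfl

omit [FiniteDimensional F K] in
theorem algebraMap_integralAut_pow_apply (σ : K ≃ₐ[F] K) (k : ℕ) (x : 𝓞 K) :
    algebraMap (𝓞 K) K ((integralAut σ ^ k) x) = (σ ^ k) (algebraMap (𝓞 K) K x) := by
  rw [integralAut_pow_apply]
  rfl

theorem integralAut_pow_finrank (σ : K ≃ₐ[F] K) :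
    integralAut σ ^ Module.finrank F K = 1 := by
  rw [integralAut, ← map_pow, galois_pow_finrank_eq_one, map_one]

omit [NumberField F] [NumberField K] [FiniteDimensional F K] [IsGalois F K] in
theorem map_le_of_map_pow_le {q : Ideal (𝓞 F)} {t : ℕ} {P : Ideal (𝓞 K)} (hP : P.IsPrime)
    (h : (q ^ t).map (algebraMap (𝓞 F) (𝓞 K)) ≤ P) : q ≤ P.under (𝓞 F) := by
  rw [Ideal.map_pow] at h
  exact Ideal.map_le_iff_le_comap.1 (hP.le_of_pow_le h)

omit [NumberField K] [FiniteDimensional F K] [IsGalois F K] in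
theorem liesOver_of_map_pow_le {q : Ideal (𝓞 F)} [q.IsPrime] (hq0 : q ≠ ⊥) {t : ℕ}
    {P : Ideal (𝓞 K)} (hP : P.IsPrime) (h : (q ^ t).map (algebraMap (𝓞 F) (𝓞 K)) ≤ P) :
    P.LiesOver q := by
  have hq : q.IsMaximal := Ideal.IsPrime.isMaximal ‹_› hq0
  exact ⟨hq.eq_of_le (Ideal.IsPrime.ne_top inferInstance) (map_le_of_map_pow_le hP h)⟩

theorem exists_integralAut_sub_notMem (σ : K ≃ₐ[F] K)
    (hσ : ∀ τ : K ≃ₐ[F] K, τ ∈ Subgroup.zpowers σ)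
    (q : Ideal (𝓞 F)) [q.IsPrime] (hq0 : q ≠ ⊥)
    (hsq : Squarefree (q.map (algebraMap (𝓞 F) (𝓞 K)))) (P : Ideal (𝓞 K)) [P.IsPrime]
    [P.LiesOver q] (i j : Fin (Module.finrank F K)) (hij : i ≠ j) :
    ∃ w, (integralAut σ ^ (i : ℕ)) w - (integralAut σ ^ (j : ℕ)) w ∉ P := by
  by_contra! hall
  -- Substituting σ^(-j)x turns agreement of the two powers modulo `P` into membership of σ^(i-j) in
  -- inertia.
  have hmem : σ ^ (i : ℕ) * (σ ^ (j : ℕ))⁻¹ ∈ P.inertia (K ≃ₐ[F] K) := by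
    intro x
    have := hall ((σ ^ (j : ℕ))⁻¹ • x)
    rwa [integralAut_pow_apply, integralAut_pow_apply, smul_inv_smul, ← mul_smul] at this
  rw [inertia_eq_bot_of_squarefree_map q hq0 hsq P, Subgroup.mem_bot, mul_inv_eq_one] at hmem
  have hord : orderOf σ = Module.finrank F K := by
    rw [orderOf_eq_card_of_forall_mem_zpowers hσ, IsGalois.card_aut_eq_finrank]
  exact hij (Fin.ext (pow_injOn_Iio_orderOf (by simp [hord]) (by simp [hord]) hmem))

theorem exists_integralAut_pow_mem_iff (σ : K ≃ₐ[F] K)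
    (hσ : ∀ τ : K ≃ₐ[F] K, τ ∈ Subgroup.zpowers σ) (q : Ideal (𝓞 F)) (P P' : Ideal (𝓞 K))
    [P.IsPrime] [P'.IsPrime] [P.LiesOver q] [P'.LiesOver q] :
    ∃ k : ℕ, ∀ x, x ∈ P' ↔ (integralAut σ ^ k) x ∈ P := by
  obtain ⟨τ, hτ⟩ := Algebra.IsInvariant.exists_smul_of_under_eq (𝓞 F) (𝓞 K) (K ≃ₐ[F] K) P P'
    ((Ideal.over_def P q).symm.trans (Ideal.over_def P' q))
  -- Finiteness of the group permits a natural exponent.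
  obtain ⟨k, hk⟩ := mem_powers_iff_mem_zpowers.2 (hσ τ⁻¹)
  have hk' : σ ^ k = τ⁻¹ := hk
  refine ⟨k, fun x => ?_⟩
  rw [integralAut_pow_apply, hk', hτ, Ideal.mem_pointwise_smul_iff_inv_smul_mem]

/-! ### The natural order modulo a power of q. -/

namespace naturalOrder

variable (σ : K ≃ₐ[F] K) (u : 𝓞 F)

/-- The natural order as a cyclic algebra over the rings of integers. -/
noncomputable def toGenCyclicAlgebra : naturalOrder F K σ u →ₐ[𝓞 F]
    GenCyclicAlgebra (𝓞 F) (𝓞 K) (Module.finrank F K) (integralAut σ)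
      (integralAut_pow_finrank σ) u :=
  AlgHom.ofLinearMap
    { toFun := fun x => ⟨naturalOrder.coeff x⟩
      map_add' := fun x y => rfl
      map_smul' := fun r x => by
        ext i
        change (r : F) • (x : CyclicAlgebra F K σ (u : F)).coeff i =
          ((r • naturalOrder.coeff x i : 𝓞 K) : K)
        rw [Algebra.smul_def, Algebra.smul_def]
        rfl }
    (by
      ext i
      change (Pi.single 0 1 : Fin _ → K) i = ((Pi.single 0 1 : Fin _ → 𝓞 K) i : K)
      rw [Pi.single_apply, Pi.single_apply]
      split_ifs <;> simp)
    (fun x y => by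
      ext k
      change ((x : CyclicAlgebra F K σ (u : F)) * y).coeff k = algebraMap (𝓞 K) K
        ((⟨naturalOrder.coeff x⟩ * ⟨naturalOrder.coeff y⟩ :
          GenCyclicAlgebra (𝓞 F) (𝓞 K) (Module.finrank F K) (integralAut σ)
            (integralAut_pow_finrank σ) u).coeff k)
      rw [GenCyclicAlgebra.coeff_mul, GenCyclicAlgebra.coeff_mul, map_sum]
      refine Finset.sum_congr rfl fun i _ => ?_
      rw [map_sum]
      refine Finset.sum_congr rfl fun j _ => ?_
      rw [apply_ite (algebraMap (𝓞 K) K), map_zero, map_mul, map_mul,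
        algebraMap_integralAut_pow_apply, apply_ite (algebraMap (𝓞 K) K), map_one]
      rfl)

/-- The monomial `a z^i` of the natural order. -/
noncomputable def monomial (i : Fin (Module.finrank F K)) : 𝓞 K →+ naturalOrder F K σ u where
  toFun a := ⟨GenCyclicAlgebra.single i (a : K), fun j => by
    rw [GenCyclicAlgebra.coeff_single, Pi.single_apply]
    split_ifs
    · exact a.isIntegral_coe
    · exact isIntegral_zero⟩
  map_zero' := Subtype.ext (GenCyclicAlgebra.ext (by simp))
  map_add' a b := Subtype.ext (by simp [GenCyclicAlgebra.single_add])

omit [NumberField F] [NumberField K] in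
theorem sum_monomial (x : naturalOrder F K σ u) :
    ∑ i, monomial σ u i (naturalOrder.coeff x i) = x := by
  apply Subtype.ext
  rw [AddSubmonoidClass.coe_finsetSum]
  exact GenCyclicAlgebra.sum_single (x : CyclicAlgebra F K σ (u : F))

omit [NumberField F] [NumberField K] in
theorem monomial_mul (i : Fin (Module.finrank F K)) (a b : 𝓞 K) :
    monomial σ u i (a * b) = monomial σ u 0 a * monomial σ u i b := by
  apply Subtype.ext
  change GenCyclicAlgebra.single i _ = GenCyclicAlgebra.single 0 _ * GenCyclicAlgebra.single i _
  rw [GenCyclicAlgebra.single_mul_single]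
  simp

omit [NumberField F] [NumberField K] in
theorem monomial_algebraMap (i : Fin (Module.finrank F K)) (r : 𝓞 F) :
    monomial σ u i (algebraMap (𝓞 F) (𝓞 K) r) =
      algebraMap (𝓞 F) (naturalOrder F K σ u) r * monomial σ u i 1 := by
  apply Subtype.ext
  change GenCyclicAlgebra.single i _ =
    algebraMap F (CyclicAlgebra F K σ (u : F)) r * GenCyclicAlgebra.single i _
  rw [GenCyclicAlgebra.algebraMap_eq, GenCyclicAlgebra.single_mul_single]
  simp
  rfl

theorem surjective_toGenCyclicAlgebra : Function.Surjective (toGenCyclicAlgebra σ u) := by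
  intro y
  refine ⟨⟨⟨fun i => (y.coeff i : K)⟩, fun i => (y.coeff i).isIntegral_coe⟩, ?_⟩
  ext i
  rfl

-- Only this inclusion needs a direct argument; the reverse one will follow because a kernel
-- containing the scalars from `I` contains the two-sided ideal they generate.
omit [NumberField F] [NumberField K] in
theorem mem_extIdeal_of_coeff_mem (I : Ideal (𝓞 F)) (x : naturalOrder F K σ u)
    (hx : ∀ i, naturalOrder.coeff x i ∈ I.map (algebraMap (𝓞 F) (𝓞 K))) :
    x ∈ extIdeal σ u I := by
  rw [← sum_monomial σ u x]
  refine sum_mem fun i _ => ?_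
  have hi := hx i
  generalize naturalOrder.coeff x i = a at hi
  induction hi using Submodule.span_induction with
  | mem a ha =>
    obtain ⟨r, hr, rfl⟩ := ha
    rw [monomial_algebraMap]
    exact TwoSidedIdeal.mul_mem_right _ _ _ (TwoSidedIdeal.subset_span ⟨r, hr, rfl⟩)
  | zero => rw [map_zero]; exact TwoSidedIdeal.zero_mem _
  | add a b _ _ ha hb => rw [map_add]; exact TwoSidedIdeal.add_mem _ ha hb
  | smul c a _ ha =>
    rw [smul_eq_mul, monomial_mul]
    exact TwoSidedIdeal.mul_mem_left _ _ _ ha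

/-- Modulo a power of an unramified prime not containing `u`, the natural order is a matrix
algebra. -/
theorem exists_algHom_matrix (hσ : ∀ τ : K ≃ₐ[F] K, τ ∈ Subgroup.zpowers σ)
    (q : Ideal (𝓞 F)) [q.IsPrime] (hq0 : q ≠ ⊥)
    (hsq : Squarefree (q.map (algebraMap (𝓞 F) (𝓞 K)))) (hu : u ∉ q) (t : ℕ) (ht : t ≠ 0) :
    ∃ f : naturalOrder F K σ u →ₐ[𝓞 F]
        Matrix (Fin (Module.finrank F K)) (Fin (Module.finrank F K)) (𝓞 F ⧸ q ^ t),
      Function.Surjective f ∧ (∀ x, f x = 0 ↔ x ∈ extIdeal σ u (q ^ t)) ∧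
        ∀ x, f x = 0 ↔ ∀ i, naturalOrder.coeff x i ∈ (q ^ t).map (algebraMap (𝓞 F) (𝓞 K)) := by
  have hqmax : q.IsMaximal := Ideal.IsPrime.isMaximal ‹_› hq0
  have hI0 : q ^ t ≠ ⊥ := pow_ne_zero _ hq0
  have hI : q ^ t ≠ ⊤ := fun h => hqmax.ne_top (top_le_iff.1 (h ▸ Ideal.pow_le_self ht))
  have : Nontrivial (𝓞 F ⧸ q ^ t) := Ideal.Quotient.nontrivial_iff.2 hI
  have : Finite (𝓞 F ⧸ q ^ t) := Ring.HasFiniteQuotients.finiteQuotient hI0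
  have : Finite (𝓞 K ⧸ (q ^ t).map (algebraMap (𝓞 F) (𝓞 K))) :=
    Ring.HasFiniteQuotients.finiteQuotient (Ideal.map_ne_bot_of_ne_bot hI0)
  have := q.free_quotient_map_pow (S := 𝓞 K) ht
  have h4 := finrank_quotient_map_ringOfIntegers (K := K) (q ^ t) hI0 hI
  -- A maximal ideal of the quotient containing the class of `u` would pull back to `q`,
  -- contradicting `hu`.
  have hunit : IsUnit (Ideal.Quotient.mk (q ^ t) u) := by
    by_contra hnu
    obtain ⟨M, hM, huM⟩ := exists_max_ideal_of_mem_nonunits hnu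
    have hle : q ≤ M.comap (Ideal.Quotient.mk (q ^ t)) :=
      (hM.isPrime.comap _).le_of_pow_le fun x hx => by
        rw [Ideal.mem_comap, Ideal.Quotient.eq_zero_iff_mem.2 hx]; exact M.zero_mem
    exact hu ((hqmax.eq_of_le (hM.isPrime.comap _).ne_top hle) ▸ huM)
  obtain ⟨f, hf, hker⟩ := GenCyclicAlgebra.exists_algHom_matrix
    (hσ := integralAut_pow_finrank σ) (u := u) (q ^ t) h4
    (fun i j hij Q hQ hle => by
      have hQp := hQ.isPrime
      have := liesOver_of_map_pow_le hq0 hQp hle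
      exact exists_integralAut_sub_notMem σ hσ q hq0 hsq Q i j hij)
    (fun Q Q' hQ hQ' hle hle' => by
      have hQp := hQ.isPrime
      have hQp' := hQ'.isPrime
      have := liesOver_of_map_pow_le hq0 hQp hle
      have := liesOver_of_map_pow_le hq0 hQp' hle'
      exact exists_integralAut_pow_mem_iff σ hσ q Q Q')
    hunit
  have hcoeff : ∀ x, f.comp (toGenCyclicAlgebra σ u) x = 0 ↔
      ∀ i, naturalOrder.coeff x i ∈ (q ^ t).map (algebraMap (𝓞 F) (𝓞 K)) := fun x =>
    hker (toGenCyclicAlgebra σ u x)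
  refine ⟨f.comp (toGenCyclicAlgebra σ u), hf.comp (surjective_toGenCyclicAlgebra σ u),
    fun x => ⟨fun hx => mem_extIdeal_of_coeff_mem σ u _ x ((hcoeff x).1 hx), fun hx => ?_⟩, hcoeff⟩
  have hle : extIdeal σ u (q ^ t) ≤ TwoSidedIdeal.ker (f.comp (toGenCyclicAlgebra σ u)) := by
    refine TwoSidedIdeal.span_le.2 ?_
    rintro _ ⟨r, hr, rfl⟩
    refine (TwoSidedIdeal.mem_ker _).2 ?_
    rw [AlgHom.commutes, IsScalarTower.algebraMap_apply (𝓞 F) (𝓞 F ⧸ q ^ t),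
      Ideal.Quotient.algebraMap_eq, Ideal.Quotient.eq_zero_iff_mem.2 hr, map_zero]
  exact (TwoSidedIdeal.mem_ker _).1 (hle hx)

end naturalOrder

end

/-! ### The theorem. -/

theorem mainTheorem7 {F K : Type*} [Field F] [Field K] [NumberField F] [NumberField K]
    [Algebra F K] [FiniteDimensional F K] [IsGalois F K]
    (σ : K ≃ₐ[F] K) (hσ : ∀ τ : K ≃ₐ[F] K, τ ∈ Subgroup.zpowers σ)
    (u : 𝓞 F)
    (q : Ideal (𝓞 F)) (hq : q.IsPrime) (hq0 : q ≠ ⊥)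
    (g : ℕ) (hg : 1 < g) (Q : Fin g → Ideal (𝓞 K)) (hQ : ∀ i, (Q i).IsPrime)
    (hQinj : Function.Injective Q)
    (hqQ : q.map (algebraMap (𝓞 F) (𝓞 K)) = ∏ i, Q i)
    (hu : u ∉ q) (s : ℕ) (hs : 1 < s) :
    Nonempty ((naturalOrder.extIdeal σ u (q ^ s)).ringCon.Quotient ≃ₐ[𝓞 F]
        Matrix (Fin (Module.finrank F K)) (Fin (Module.finrank F K)) (𝓞 F ⧸ q ^ s)) ∧
    (∀ J : TwoSidedIdeal (naturalOrder F K σ u),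
      (J ≠ ⊤ ∧ naturalOrder.extIdeal σ u (q ^ s) ≤ J) ↔
        ∃ t : ℕ, 1 ≤ t ∧ t ≤ s ∧ J = naturalOrder.extIdeal σ u (q ^ t)) ∧
    ∀ t : ℕ, 1 ≤ t → t ≤ s →
      (∀ x : naturalOrder F K σ u, x ∈ naturalOrder.extIdeal σ u (q ^ t) ↔
        ∀ j, naturalOrder.coeff x j ∈ (q ^ t).map (algebraMap (𝓞 F) (𝓞 K))) ∧
      Nonempty ((naturalOrder.extIdeal σ u (q ^ t)).ringCon.Quotient ≃ₐ[𝓞 F]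
        Matrix (Fin (Module.finrank F K)) (Fin (Module.finrank F K)) (𝓞 F ⧸ q ^ t)) := by
  have hqmax : q.IsMaximal := hq.isMaximal hq0
  have hsq : Squarefree (q.map (algebraMap (𝓞 F) (𝓞 K))) := by
    have hprime : ∀ i, Prime (Q i) := fun i => by
      refine Ideal.prime_of_isPrime (fun h0 => ?_) (hQ i)
      refine Ideal.map_ne_bot_of_ne_bot (S := 𝓞 K) hq0 (hqQ.trans ?_)
      exact Finset.prod_eq_zero (Finset.mem_univ i) h0
    rw [hqQ]
    refine Finset.squarefree_prod_of_pairwise_isCoprime (fun i _ j _ hij => ?_)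
      fun i _ => (hprime i).squarefree
    have hi : (Q i).IsMaximal := (hQ i).isMaximal (hprime i).ne_zero
    have hj : (Q j).IsMaximal := (hQ j).isMaximal (hprime j).ne_zero
    exact (Ideal.isCoprime_iff_sup_eq.2
      (Ideal.IsMaximal.coprime_of_ne hi hj (hQinj.ne hij))).isRelPrime
  have hmain := fun t ht => naturalOrder.exists_algHom_matrix σ u hσ q hq0 hsq hu t ht
  have hiso : ∀ t, 1 ≤ t → Nonempty ((naturalOrder.extIdeal σ u (q ^ t)).ringCon.Quotient ≃ₐ[𝓞 F]
      Matrix (Fin (Module.finrank F K)) (Fin (Module.finrank F K)) (𝓞 F ⧸ q ^ t)) := by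
    intro t ht
    obtain ⟨f, hf, hker, -⟩ := hmain t (by omega)
    exact TwoSidedIdeal.nonempty_quotient_algEquiv _ f hf hker
  refine ⟨hiso s hs.le, fun J => ⟨?_, ?_⟩, fun t ht _ => ⟨fun x => ?_, hiso t ht⟩⟩
  · rintro ⟨hJtop, hJ⟩
    obtain ⟨f, hf, hker, -⟩ := hmain s (by omega)
    have hJeq := TwoSidedIdeal.eq_span_of_surjective_matrix (q ^ s) f hf
      (fun x hx => (hker x).1 hx) J hJ
    -- The contraction of `J`, which determines `J` by `hJeq`. It divides `q ^ s`, hence is some `q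
    -- ^ t`; the exponent 0 would give `J = ⊤`.
    let I : Ideal (𝓞 F) :=
      { carrier := {r | algebraMap (𝓞 F) (naturalOrder F K σ u) r ∈ J}
        zero_mem' := by rw [Set.mem_ofPred_eq, map_zero]; exact J.zero_mem
        add_mem' := fun {a b} ha hb => by
          rw [Set.mem_ofPred_eq, map_add]; exact J.add_mem ha hb
        smul_mem' := fun c {a} ha => by
          rw [Set.mem_ofPred_eq, smul_eq_mul, map_mul]; exact J.mul_mem_left _ _ ha }
    have hI : q ^ s ≤ I := fun r hr => hJ (TwoSidedIdeal.subset_span ⟨r, hr, rfl⟩)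
    obtain ⟨t, hts, hIt⟩ := (dvd_prime_pow (Ideal.prime_of_isPrime hq0 hq) s).1
      (Ideal.dvd_iff_le.2 hI)
    rw [associated_iff_eq] at hIt
    refine ⟨t, Nat.one_le_iff_ne_zero.2 fun ht => hJtop ?_, hts, ?_⟩
    · have h1 : (1 : 𝓞 F) ∈ I := by rw [hIt, ht, pow_zero, Ideal.one_eq_top]; trivial
      have h1' : algebraMap (𝓞 F) (naturalOrder F K σ u) 1 ∈ J := h1
      rw [map_one] at h1'
      exact (TwoSidedIdeal.one_mem_iff J).1 h1'
    · rw [naturalOrder.extIdeal, ← hIt]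
      exact hJeq
  · rintro ⟨t, ht, hts, rfl⟩
    refine ⟨fun htop => ?_, TwoSidedIdeal.span_mono (Set.image_mono (Ideal.pow_le_pow_right hts))⟩
    obtain ⟨f, -, hker, -⟩ := hmain t (by omega)
    have h1 := (hker 1).2 (by rw [htop]; trivial)
    have : Nontrivial (𝓞 F ⧸ q ^ t) := Ideal.Quotient.nontrivial_iff.2 fun h =>
      hqmax.ne_top (top_le_iff.1 (h ▸ Ideal.pow_le_self (by omega)))
    rw [map_one] at h1
    exact one_ne_zero h1
  · obtain ⟨f, -, hker, hcoeff⟩ := hmain t (by omega)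
    exact (hker x).symm.trans (hcoeff x)
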